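/- Let $\Gamma$ be a torsionless commutative cancellative monoid (written additively; torsionless means that $n\alpha=n\beta$ with $n\ge 1$ implies $\alpha=\beta$), with quotient group $\langle\Gamma\rangle=\{\alpha-\beta\mid\alpha,\beta\in\Gamma\}$, let $R=\bigoplus_{\alpha\in\Gamma}R_\alpha$ be an integral domain graded by $\Gamma$, and let $K$ be its quotient field. Let $H$ be the set of nonzero homogeneous elements of $R$. Its localization $R_H\subseteq K$ is graded by $\langle\Gamma\rangle$; for $\alpha\in\langle\Gamma\rangle$, the component $(R_H)_\alpha$ consists of $0$ and the fractions $a/b$ with $a\in R_\beta$, $0\ne b\in R_\gamma$, $\beta-\gamma=\alpha$. A semistar operation on $R$ is a map $\star\colon E\mapsto E^\star$ from the set $\overline{\mathcal F}(R)$ of all nonzero $R$-submodules of $K$ to itself such that, for all $0\neq x\in K$ and all $E,F\in\overline{\mathcal F}(R)$: $(xE)^\star=xE^\star$; $E\subseteq F$ implies $E^\star\subseteq F^\star$; $E\subseteq E^\star$; and $(E^\star)^\star=E^\star$. A nonzero fractional ideal $E$ of $R$ is homogeneous if $sE$ is a homogeneous integral ideal of $R$ for some $s\in H$. The operation $\star$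 is called homogeneous preserving if for every nonzero homogeneous fractional ideal $E$ of $R$ the module $E^\star$ is a homogeneous submodule of $R_H$, that is, $E^\star=\bigoplus_{\alpha\in\langle\Gamma\rangle}\bigl(E^\star\cap (R_H)_\alpha\bigr)$. Let $f(R)$ be the set of nonzero finitely generated fractional ideals of $R$ (equivalently, of nonzero finitely generated $R$-submodules of $K$). For a semistar operation $\star$ on $R$, the associated e.a.b. semistar operation of finite type $\star_a$ is defined, for $F\in f(R)$ and $E\in\overline{\mathcal F}(R)$, by $$F^{\star_a}=\bigcup\{\,((FJ)^\star:J^\star)\mid J\in f(R)\,\},\qquad E^{\star_a}=\bigcup\{\,F^{\star_a}\mid F\in f(R),\ F\subseteq E\,\},$$ where $(A:B)=\{x\in K\mid xB\subseteq A\}$. If $\star$ is a homogeneous preserving semistar operation on $R$, then $\star_a$ is also a homogeneous preserving semistar operation on $R$. -/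

import Mathlib

open scoped Pointwise

section Semistar

variable (R K : Type*) [CommRing R] [Field K] [Algebra R K]

/-- The set of all nonzero `R`-submodules of `K`. -/
abbrev NonzeroSubmodule : Type _ := {E : Submodule R K // E ≠ ⊥}

variable {R K}

namespace NonzeroSubmodule

theorem exists_ne_zero (E : NonzeroSubmodule R K) : ∃ x ∈ E.1, x ≠ 0 :=
  (Submodule.ne_bot_iff _).1 E.2

/-- The product `E F`, generated by all products `x y` with `x ∈ E` and `y ∈ F`. -/
instance instMul : Mul (NonzeroSubmodule R K) where
  mul E F := ⟨E.1 * F.1, by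
    obtain ⟨x, hx, hx0⟩ := E.exists_ne_zero
    obtain ⟨y, hy, hy0⟩ := F.exists_ne_zero
    exact (Submodule.ne_bot_iff _).2 ⟨x * y, Submodule.mul_mem_mul hx hy, mul_ne_zero hx0 hy0⟩⟩

theorem coe_mul (E F : NonzeroSubmodule R K) :
    ((E * F : NonzeroSubmodule R K) : Submodule R K) = E.1 * F.1 := rfl

/-- The submodule `x E = {x y | y ∈ E}` for a nonzero element `x` of `K`. -/
def scale (x : K) (hx : x ≠ 0) (E : NonzeroSubmodule R K) : NonzeroSubmodule R K :=
  ⟨x • E.1, by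
    obtain ⟨y, hy, hy0⟩ := E.exists_ne_zero
    exact (Submodule.ne_bot_iff _).2
      ⟨x * y, Submodule.smul_mem_pointwise_smul y x _ hy, mul_ne_zero hx hy0⟩⟩

theorem mem_scale {x : K} {hx : x ≠ 0} {E : NonzeroSubmodule R K} {z : K} :
    z ∈ (scale x hx E).1 ↔ ∃ y ∈ E.1, x * y = z :=
  Submodule.mem_smul_pointwise_iff_exists z x E.1

/-- The cyclic submodule `R y` for a nonzero element `y` of `K`. -/
def cyclic (y : K) (hy : y ≠ 0) : NonzeroSubmodule R K :=
  ⟨Submodule.span R {y}, by simpa using hy⟩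

theorem cyclic_fg (y : K) (hy : y ≠ 0) : (cyclic (R := R) y hy).1.FG :=
  Submodule.fg_span_singleton y

end NonzeroSubmodule

variable (R K) in
/-- A semistar operation on the domain `R` with quotient field `K`. -/
structure SemistarOperation where
  /-- The map `E ↦ E^⋆` on nonzero `R`-submodules of `K`. -/
  toFun : NonzeroSubmodule R K → NonzeroSubmodule R K
  map_scale : ∀ (x : K) (hx : x ≠ 0) (E : NonzeroSubmodule R K),
    toFun (E.scale x hx) = (toFun E).scale x hx
  mono : ∀ E F : NonzeroSubmodule R K, E ≤ F → toFun E ≤ toFun F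
  le_map : ∀ E : NonzeroSubmodule R K, E ≤ toFun E
  map_map : ∀ E : NonzeroSubmodule R K, toFun (toFun E) = toFun E

namespace SemistarOperation

open NonzeroSubmodule

instance instCoeFun : CoeFun (SemistarOperation R K)
    (fun _ => NonzeroSubmodule R K → NonzeroSubmodule R K) := ⟨toFun⟩

variable (s : SemistarOperation R K)

theorem mul_mem_star {A B : NonzeroSubmodule R K} {x y : K} (hx : x ∈ (s A).1) (hy : y ∈ B.1) :
    x * y ∈ (s (A * B)).1 := by
  by_cases hy0 : y = 0
  · simp [hy0]
  have h1 : A.scale y hy0 ≤ A * B := by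
    intro z hz
    obtain ⟨a, ha, rfl⟩ := mem_scale.1 hz
    rw [mul_comm, coe_mul]
    exact Submodule.mul_mem_mul ha hy
  apply s.mono _ _ h1
  rw [s.map_scale]
  exact mem_scale.2 ⟨x, hx, mul_comm _ _⟩

theorem star_le_star_of_le {A B : NonzeroSubmodule R K} (h : A ≤ s B) : s A ≤ s B := by
  have := s.mono _ _ h
  rwa [s.map_map] at this

/-- To test `x H^⋆ ⊆ E^⋆` it suffices to test `x H ⊆ E^⋆`. -/
theorem mem_div_star {E H : NonzeroSubmodule R K} {x : K} :
    x ∈ (s E).1 / (s H).1 ↔ ∀ y ∈ H.1, x * y ∈ (s E).1 := by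
  rw [Submodule.mem_div_iff_forall_mul_mem]
  refine ⟨fun h y hy => h y (s.le_map H hy), fun h y hy => ?_⟩
  by_cases hx : x = 0
  · simp [hx]
  have h1 : H.scale x hx ≤ s E := by
    intro z hz
    obtain ⟨a, ha, rfl⟩ := mem_scale.1 hz
    exact h a ha
  apply s.star_le_star_of_le h1
  rw [s.map_scale]
  exact mem_scale.2 ⟨y, hy, rfl⟩

theorem mem_div_mul_right {F H : NonzeroSubmodule R K} (H' : NonzeroSubmodule R K) {x : K}
    (h : x ∈ (s (F * H)).1 / (s H).1) : x ∈ (s (F * (H * H'))).1 / (s (H * H')).1 := by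
  rw [mem_div_star] at h ⊢
  intro y hy
  rw [coe_mul] at hy
  induction hy using Submodule.mul_induction_on' with
  | mem_mul_mem m hm n hn =>
    have := s.mul_mem_star (h m hm) hn
    rw [← mul_assoc]
    have e : F * H * H' = F * (H * H') := Subtype.ext (mul_assoc F.1 H.1 H'.1)
    rwa [e] at this
  | add a _ b _ ha hb => rw [mul_add]; exact add_mem ha hb

theorem mem_div_mul_left {F H : NonzeroSubmodule R K} (H' : NonzeroSubmodule R K) {x : K}
    (h : x ∈ (s (F * H)).1 / (s H).1) : x ∈ (s (F * (H' * H))).1 / (s (H' * H)).1 := by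
  have e : H' * H = H * H' := Subtype.ext (mul_comm H'.1 H.1)
  rw [e]
  exact s.mem_div_mul_right H' h

theorem mem_div_mono {F F' H : NonzeroSubmodule R K} (hF : F ≤ F') {x : K}
    (h : x ∈ (s (F * H)).1 / (s H).1) : x ∈ (s (F' * H)).1 / (s H).1 := by
  rw [mem_div_star] at h ⊢
  intro y hy
  have hle : F * H ≤ F' * H := Submodule.mul_le.2 fun m hm n hn =>
    Submodule.mul_mem_mul (hF hm) hn
  exact s.mono _ _ hle (h y hy)

/-- For finitely generated `F`, the union of the submodules
`((F H)^⋆ : H^⋆) = {x ∈ K | x H^⋆ ⊆ (F H)^⋆}`, over all nonzero finitely generated `H`. -/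
def eabFG (F : NonzeroSubmodule R K) : Submodule R K where
  carrier := {x | ∃ H : NonzeroSubmodule R K, H.1.FG ∧ x ∈ (s (F * H)).1 / (s H).1}
  zero_mem' := ⟨cyclic 1 one_ne_zero, cyclic_fg _ _, zero_mem _⟩
  add_mem' := by
    rintro a b ⟨H, hH, ha⟩ ⟨H', hH', hb⟩
    exact ⟨H * H', Submodule.FG.mul hH hH',
      add_mem (s.mem_div_mul_right H' ha) (s.mem_div_mul_left H hb)⟩
  smul_mem' := by
    rintro r a ⟨H, hH, ha⟩
    exact ⟨H, hH, Submodule.smul_mem _ _ ha⟩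

theorem eabFG_mono {F F' : NonzeroSubmodule R K} (h : F ≤ F') : s.eabFG F ≤ s.eabFG F' := by
  rintro x ⟨H, hH, hx⟩
  exact ⟨H, hH, s.mem_div_mono h hx⟩

theorem le_eabFG (F : NonzeroSubmodule R K) : F.1 ≤ s.eabFG F := by
  intro x hx
  refine ⟨cyclic 1 one_ne_zero, cyclic_fg _ _, s.mem_div_star.2 fun y hy => ?_⟩
  exact s.le_map _ (Submodule.mul_mem_mul hx hy)

theorem exists_fg_le (E : NonzeroSubmodule R K) {x : K} (hx : x ∈ E.1) :
    ∃ F : NonzeroSubmodule R K, F.1.FG ∧ F ≤ E ∧ x ∈ F.1 := by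
  by_cases hx0 : x = 0
  · obtain ⟨y, hy, hy0⟩ := E.exists_ne_zero
    exact ⟨cyclic y hy0, cyclic_fg _ _, (Submodule.span_singleton_le_iff_mem y E.1).2 hy,
      by simp [hx0]⟩
  · exact ⟨cyclic x hx0, cyclic_fg _ _, (Submodule.span_singleton_le_iff_mem x E.1).2 hx,
      Submodule.mem_span_singleton_self x⟩

theorem exists_fg_sup {E F F' : NonzeroSubmodule R K} (hF : F.1.FG) (hF' : F'.1.FG)
    (h : F ≤ E) (h' : F' ≤ E) :
    ∃ G : NonzeroSubmodule R K, G.1.FG ∧ G ≤ E ∧ F ≤ G ∧ F' ≤ G :=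
  ⟨⟨F.1 ⊔ F'.1, fun e => F.2 (sup_eq_bot_iff.1 e).1⟩, hF.sup hF', sup_le (α := Submodule R K) h h',
    le_sup_left (α := Submodule R K), le_sup_right (α := Submodule R K)⟩

/-- The union of the submodules `eabFG F` over all nonzero finitely generated `F ⊆ E`. -/
def eabSubmodule (E : NonzeroSubmodule R K) : Submodule R K where
  carrier := {x | ∃ F : NonzeroSubmodule R K, F.1.FG ∧ F ≤ E ∧ x ∈ s.eabFG F}
  zero_mem' := by
    obtain ⟨F, hF, hFE, h0⟩ := exists_fg_le E (zero_mem E.1)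
    exact ⟨F, hF, hFE, zero_mem _⟩
  add_mem' := by
    rintro a b ⟨F, hF, hFE, ha⟩ ⟨F', hF', hFE', hb⟩
    obtain ⟨G, hG, hGE, h, h'⟩ := exists_fg_sup hF hF' hFE hFE'
    exact ⟨G, hG, hGE, add_mem (s.eabFG_mono h ha) (s.eabFG_mono h' hb)⟩
  smul_mem' := by
    rintro r a ⟨F, hF, hFE, ha⟩
    exact ⟨F, hF, hFE, Submodule.smul_mem _ _ ha⟩

theorem le_eabSubmodule (E : NonzeroSubmodule R K) : E.1 ≤ s.eabSubmodule E := by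
  intro x hx
  obtain ⟨F, hF, hFE, hxF⟩ := exists_fg_le E hx
  exact ⟨F, hF, hFE, s.le_eabFG F hxF⟩

/-- For finitely generated `F` the two descriptions agree. -/
theorem eabSubmodule_of_fg {F : NonzeroSubmodule R K} (hF : F.1.FG) :
    s.eabSubmodule F = s.eabFG F :=
  le_antisymm (fun _ ⟨_, _, hG, hx⟩ => s.eabFG_mono hG hx) fun _ hx => ⟨F, hF, le_rfl, hx⟩

/-- The map `E ↦ E^{⋆_a}`. -/
def eabFun (E : NonzeroSubmodule R K) : NonzeroSubmodule R K :=
  ⟨s.eabSubmodule E, fun h => E.2 (le_bot_iff.1 ((s.le_eabSubmodule E).trans h.le))⟩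

theorem eabFun_mono {E F : NonzeroSubmodule R K} (h : E ≤ F) : s.eabFun E ≤ s.eabFun F := by
  rintro x ⟨G, hG, hGE, hx⟩
  exact ⟨G, hG, le_trans hGE h, hx⟩

theorem scale_fg {F : NonzeroSubmodule R K} (hF : F.1.FG) (c : K) (hc : c ≠ 0) :
    (F.scale c hc).1.FG :=
  hF.map (DistribSMul.toLinearMap R K c)

theorem scale_eabFun_le (c : K) (hc : c ≠ 0) (E : NonzeroSubmodule R K) :
    (s.eabFun E).scale c hc ≤ s.eabFun (E.scale c hc) := by
  intro z hz
  obtain ⟨x, ⟨F, hF, hFE, H, hH, hx⟩, rfl⟩ := mem_scale.1 hz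
  refine ⟨F.scale c hc, scale_fg hF c hc, ?_, H, hH, ?_⟩
  · intro w hw
    obtain ⟨v, hv, rfl⟩ := mem_scale.1 hw
    exact mem_scale.2 ⟨v, hFE hv, rfl⟩
  · rw [mem_div_star] at hx ⊢
    intro y hy
    have e : (F * H).scale c hc ≤ F.scale c hc * H := by
      intro w hw
      obtain ⟨v, hv, rfl⟩ := mem_scale.1 hw
      rw [coe_mul] at hv
      induction hv using Submodule.mul_induction_on' with
      | mem_mul_mem m hm n hn =>
        rw [← mul_assoc]
        exact Submodule.mul_mem_mul (mem_scale.2 ⟨m, hm, rfl⟩) hn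
      | add a ha b hb iha ihb =>
        rw [mul_add]
        exact add_mem (iha (mem_scale.2 ⟨a, ha, rfl⟩)) (ihb (mem_scale.2 ⟨b, hb, rfl⟩))
    apply s.mono _ _ e
    rw [s.map_scale, mul_assoc]
    exact mem_scale.2 ⟨_, hx y hy, rfl⟩

theorem eabFun_scale (c : K) (hc : c ≠ 0) (E : NonzeroSubmodule R K) :
    s.eabFun (E.scale c hc) = (s.eabFun E).scale c hc := by
  refine le_antisymm (fun z hz => ?_) (s.scale_eabFun_le c hc E)
  have hci : c⁻¹ ≠ 0 := inv_ne_zero hc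
  have h := s.scale_eabFun_le c⁻¹ hci (E.scale c hc) (mem_scale.2 ⟨z, hz, rfl⟩)
  have e : (E.scale c hc).scale c⁻¹ hci = E := by
    apply Subtype.ext
    ext w
    constructor
    · intro hw
      obtain ⟨v, hv, rfl⟩ := mem_scale.1 hw
      obtain ⟨u, hu, rfl⟩ := mem_scale.1 hv
      rwa [inv_mul_cancel_left₀ hc]
    · intro hw
      exact mem_scale.2 ⟨c * w, mem_scale.2 ⟨w, hw, rfl⟩, inv_mul_cancel_left₀ hc w⟩
  rw [e] at h
  exact mem_scale.2 ⟨_, h, mul_inv_cancel_left₀ hc z⟩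

/-- A finitely generated submodule of the directed union `E^{⋆_a}` is carried by single
finitely generated `F ⊆ E` and `H`. -/
theorem exists_of_fg_le {E : NonzeroSubmodule R K} {G : Submodule R K} (hG : G.FG)
    (h : G ≤ s.eabSubmodule E) : ∃ F H : NonzeroSubmodule R K, F.1.FG ∧ F ≤ E ∧ H.1.FG ∧
      G ≤ (s (F * H)).1 / (s H).1 := by
  induction G, hG using Submodule.fg_induction with
  | singleton x =>
    obtain ⟨F, hF, hFE, H, hH, hx⟩ := h (Submodule.mem_span_singleton_self x)
    exact ⟨F, H, hF, hFE, hH, (Submodule.span_singleton_le_iff_mem _ _).2 hx⟩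
  | sup M N hM hN ihM ihN =>
    obtain ⟨F, H, hF, hFE, hH, h1⟩ := ihM (le_sup_left.trans h)
    obtain ⟨F', H', hF', hFE', hH', h2⟩ := ihN (le_sup_right.trans h)
    obtain ⟨L, hL, hLE, hFL, hFL'⟩ := exists_fg_sup hF hF' hFE hFE'
    exact ⟨L, H * H', hL, hLE, Submodule.FG.mul hH hH', sup_le
      (fun x hx => s.mem_div_mono hFL (s.mem_div_mul_right H' (h1 hx)))
      (fun x hx => s.mem_div_mono hFL' (s.mem_div_mul_left H (h2 hx)))⟩

theorem eabFun_eabFun (E : NonzeroSubmodule R K) : s.eabFun (s.eabFun E) = s.eabFun E := by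
  refine le_antisymm ?_ (s.le_eabSubmodule _)
  rintro x ⟨G, hG, hGE, H', hH', hx⟩
  obtain ⟨F, H, hF, hFE, hH, h⟩ := s.exists_of_fg_le hG hGE
  refine ⟨F, hF, hFE, H * H', Submodule.FG.mul hH hH', ?_⟩
  have hx' := s.mem_div_mul_left H hx
  rw [mem_div_star] at hx' ⊢
  have hle : G * (H * H') ≤ s (F * (H * H')) := by
    refine Submodule.mul_le.2 fun g hg y hy => ?_
    exact s.mem_div_star.1 (s.mem_div_mul_right H' (h hg)) y hy
  exact fun y hy => s.star_le_star_of_le hle (hx' y hy)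

/-- The e.a.b. semistar operation of finite type `⋆_a` associated to the semistar operation `⋆`:
`F^{⋆_a} = ⋃ ((F H)^⋆ : H^⋆)` over all nonzero finitely generated `H`, if `F` is finitely generated,
and in general `E^{⋆_a} = ⋃ F^{⋆_a}` over all nonzero finitely generated `F ⊆ E`. -/
def eab : SemistarOperation R K where
  toFun := s.eabFun
  map_scale := s.eabFun_scale
  mono _ _ h := s.eabFun_mono h
  le_map := s.le_eabSubmodule
  map_map := s.eabFun_eabFun

end SemistarOperation

end Semistar

section Graded

variable {Γ R : Type*} [AddCancelCommMonoid Γ] [DecidableEq Γ] [CommRing R] [IsDomain R]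
variable (𝒜 : Γ → AddSubgroup R) [GradedRing 𝒜]
variable (K : Type*) [Field K] [Algebra R K] [IsFractionRing R K]

/-- The component `(R_H)_α`, for `α` in the quotient group `⟨Γ⟩`, of the homogeneous quotient field
`R_H ⊆ K`: all fractions `a / b` with `a ∈ R_β`, `0 ≠ b ∈ R_γ` and `β - γ = α`. The element `0` is
listed separately because for some `α` there may be no such fraction at all. -/
def homogeneousQuotientComponent (α : Algebra.GrothendieckAddGroup Γ) : AddSubgroup K where
  carrier := {x | x = 0 ∨ ∃ (β γ : Γ) (a b : R), a ∈ 𝒜 β ∧ b ∈ 𝒜 γ ∧ b ≠ 0 ∧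
    Algebra.GrothendieckAddGroup.of β - Algebra.GrothendieckAddGroup.of γ = α ∧
    x = algebraMap R K a / algebraMap R K b}
  zero_mem' := Or.inl rfl
  add_mem' := by
    rintro x y (rfl | ⟨β, γ, a, b, ha, hb, hb0, h, rfl⟩) hy
    · simpa using hy
    rcases hy with rfl | ⟨β', γ', a', b', ha', hb', hb0', h', rfl⟩
    · exact Or.inr ⟨β, γ, a, b, ha, hb, hb0, h, by simp⟩
    have hβ : β' + γ = β + γ' := by
      apply Algebra.GrothendieckAddGroup.of_injective
      rw [map_add, map_add]
      exact (sub_eq_sub_iff_add_eq_add.1 (h'.trans h.symm))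
    refine Or.inr ⟨β + γ', γ + γ', a * b' + a' * b, b * b', add_mem (SetLike.mul_mem_graded ha hb')
      (hβ ▸ SetLike.mul_mem_graded ha' hb), SetLike.mul_mem_graded hb hb', mul_ne_zero hb0 hb0',
      ?_, ?_⟩
    · rw [map_add, map_add, add_sub_add_right_eq_sub, h]
    · have h1 : algebraMap R K b ≠ 0 := by simpa using hb0
      have h2 : algebraMap R K b' ≠ 0 := by simpa using hb0'
      rw [div_add_div _ _ h1 h2]
      simp only [map_add, map_mul]
      ring
  neg_mem' := by
    rintro x (rfl | ⟨β, γ, a, b, ha, hb, hb0, h, rfl⟩)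
    · exact Or.inl neg_zero
    · exact Or.inr ⟨β, γ, -a, b, neg_mem ha, hb, hb0, h, by rw [map_neg, neg_div]⟩

variable {K}

/-- A fractional ideal `E` of `R` is homogeneous if `s E` is a homogeneous integral ideal of `R`
for some nonzero homogeneous element `s` of `R`. -/
def IsHomogeneousFractionalIdeal (E : Submodule R K) : Prop :=
  ∃ s : R, s ≠ 0 ∧ SetLike.IsHomogeneousElem 𝒜 s ∧
    ∃ I : Ideal R, I.IsHomogeneous 𝒜 ∧ s • E = IsLocalization.coeSubmodule K I

/-- An `R`-submodule `E` of `K` is homogeneous if `E = ⨁ (E ∩ (R_H)_α)`, the sum over all `α ∈ ⟨Γ⟩`;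
in particular `E ⊆ R_H`. The sum is automatically direct, since the sum of the components `(R_H)_α`
is direct. -/
def IsHomogeneousSubmodule (E : Submodule R K) : Prop :=
  E.toAddSubgroup = ⨆ α, E.toAddSubgroup ⊓ homogeneousQuotientComponent 𝒜 K α

/-- A semistar operation is homogeneous preserving if it sends (nonzero) homogeneous fractional
ideals of `R` to homogeneous submodules of `R_H`. -/
def SemistarOperation.IsHomogeneousPreserving (s : SemistarOperation R K) : Prop :=
  ∀ E : NonzeroSubmodule R K, IsHomogeneousFractionalIdeal 𝒜 E.1 →
    IsHomogeneousSubmodule 𝒜 (s E).1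

end Graded

/-! Let `x H^⋆ ⊆ (F H)^⋆` with `F ⊆ E` finitely generated and `E` homogeneous. One may enlarge `F`
inside `E` until it has finitely many homogeneous generators, and scale `H` until it is generated by
finitely many `r ∈ R`. Let `D ⊇ H` be generated by the homogeneous components of these `r`.

Iteration gives `x^n r ∈ (F^n D)^⋆ ⊆ R_H` for all `n`, so `x` is almost integral over `R_H`. As
`R_H` is completely integrally closed (`mem_homogeneousQuotient_of_forall_pow_mul_mem`), `x ∈ R_H`.
The components of each `x r` lie in `(F D)^⋆`. Writing `c` for the module generated by the
components, the Dedekind–Mertens inequality `c(x) c(r) J ⊆ c(x r) J`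
(`exists_content_mul_content_mul_le`) yields `c(x) D J ⊆ (F D J)^⋆`. Hence every component of `x`
lies in `((F D J)^⋆ : (D J)^⋆) ⊆ E^{⋆_a}`.

Elements of `R_H` are represented in `K[⟨Γ⟩]` with `α`-th coefficient in `(R_H)_α`; summing the
coefficients recovers the element. Complete integral closedness is transferred from `K[ℚ]`, a
directed union of Laurent polynomial rings. -/

/-! ### Divisibility in principal ideal domains. -/

section PrincipalIdealDomain

/-- A principal ideal domain is completely integrally closed. -/
theorem dvd_of_forall_pow_dvd_mul_pow {A : Type*} [CommRing A] [IsDomain A]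
    [IsPrincipalIdealRing A] {g h d : A} (hd : d ≠ 0) (hh : h ≠ 0)
    (H : ∀ n : ℕ, h ^ n ∣ d * g ^ n) : h ∣ g := by
  obtain ⟨h', hh'⟩ := IsBezout.gcd_dvd_left h g
  obtain ⟨g', hg'⟩ := IsBezout.gcd_dvd_right h g
  obtain ⟨u, v, huv⟩ := IsBezout.gcd_eq_sum h g
  generalize IsBezout.gcd h g = c at hh' hg' huv
  have hc0 : c ≠ 0 := fun e => hh (by rw [hh', e, zero_mul])
  have hcop : IsCoprime h' g' := by
    refine ⟨u, v, mul_left_cancel₀ hc0 ?_⟩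
    linear_combination huv - u * hh' - v * hg'
  -- Cancelling `c ^ n` leaves `h' ^ n ∣ d * g' ^ n`, and coprimality removes `g' ^ n`. A non-unit
  -- has finite multiplicity in `d ≠ 0`, so `h'` is a unit.
  have hpow : ∀ n : ℕ, h' ^ n ∣ d := by
    intro n
    have h1 := H n
    rw [hh', hg', mul_pow, mul_pow, mul_left_comm] at h1
    exact (hcop.pow (m := n) (n := n)).dvd_of_dvd_mul_right
      ((mul_dvd_mul_iff_left (pow_ne_zero n hc0)).1 h1)
  have hu : IsUnit h' := by
    by_contra hu
    obtain ⟨n, hn⟩ := FiniteMultiplicity.of_not_isUnit hu hd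
    exact hn (hpow (n + 1))
  rw [hh', hg']
  exact mul_dvd_mul_left _ hu.dvd

/-- Every ideal of a localization is extended from its contraction. -/
theorem IsLocalization.isPrincipalIdealRing {A B : Type*} [CommRing A] [CommRing B]
    [Algebra A B] (M : Submonoid A) [IsLocalization M B] [IsPrincipalIdealRing A] :
    IsPrincipalIdealRing B := by
  refine ⟨fun I => ?_⟩
  rw [← IsLocalization.map_under (S := B) M I]
  infer_instance

end PrincipalIdealDomain

/-! ### Divisibility and coefficients in group algebras. -/

namespace AddMonoidAlgebra

variable {R K A B : Type*} [CommRing R] [Field K] [Algebra R K]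

theorem isPrincipalIdealRing_int : IsPrincipalIdealRing (AddMonoidAlgebra K ℤ) :=
  IsLocalization.isPrincipalIdealRing (B := LaurentPolynomial K)
    (Submonoid.powers (Polynomial.X : Polynomial K))

theorem coeff_mul_mem [Add A] (P : AddSubgroup K) {f g : AddMonoidAlgebra K A} {c : A}
    (h : ∀ a b, a + b = c → f.coeff a * g.coeff b ∈ P) : (f * g).coeff c ∈ P := by
  classical
  rw [coeff_mul]
  refine sum_mem fun a _ => sum_mem fun b _ => ?_
  dsimp only
  split_ifs with e
  · exact h a b e
  · exact zero_mem _

section MapDomain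

variable [AddCommGroup A] [AddCommGroup B]

/-- Translation by `i a` preserves both the image of `i` and its complement, so discarding exponents
outside the image is `K[A]`-linear. This retraction carries a quotient in `K[B]` back to `K[A]`. -/
theorem comapDomain_mapDomain_mul (i : A →+ B) (hi : Function.Injective i)
    (p : AddMonoidAlgebra K A) (y : AddMonoidAlgebra K B) :
    comapDomain i hi (mapDomain i p * y) = p * comapDomain i hi y := by
  induction p using induction_linear with
  | zero => simp
  | add p q hp hq => rw [mapDomain_add, add_mul, comapDomain_add, hp, hq, add_mul]
  | single a r =>
    rw [mapDomain_single]
    ext b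
    rw [coeff_comapDomain, Finsupp.comapDomain_apply, coeff_single_mul_apply,
      coeff_single_mul_apply, coeff_comapDomain, Finsupp.comapDomain_apply, map_add i, map_neg i]

theorem dvd_of_mapDomain_dvd_mapDomain (i : A →+ B) (hi : Function.Injective i)
    {p q : AddMonoidAlgebra K A} (h : mapDomain i p ∣ mapDomain i q) : p ∣ q := by
  obtain ⟨y, hy⟩ := h
  refine ⟨comapDomain i hi y, ?_⟩
  rw [← comapDomain_mapDomain_mul, ← hy]
  have h1 : comapDomain i hi (1 : AddMonoidAlgebra K B) = 1 := by
    rw [one_def, ← map_zero i, comapDomain_single_map, one_def]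
  rw [← mul_one (mapDomain i q), comapDomain_mapDomain_mul, h1, mul_one]

end MapDomain

theorem exists_pos_forall_mul_mem_range (s : Finset ℚ) :
    ∃ N : ℕ, 0 < N ∧ ∀ q ∈ s, ∃ z : ℤ, q = z / N := by
  refine ⟨∏ q ∈ s, q.den, Finset.prod_pos fun (q : ℚ) _ => q.pos, fun q hq => ?_⟩
  obtain ⟨m, hm⟩ := Finset.dvd_prod_of_mem (fun q : ℚ => q.den) hq
  refine ⟨q.num * m, ?_⟩
  have hpos : (0 : ℚ) < (∏ q ∈ s, q.den : ℕ) := by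
    exact_mod_cast Finset.prod_pos fun (q : ℚ) _ => q.pos
  rw [eq_div_iff hpos.ne', hm]
  push_cast
  rw [← mul_assoc, Rat.mul_den_eq_num]

/-- The group algebra `K[ℚ]` is completely integrally closed. -/
theorem dvd_of_forall_pow_dvd_mul_pow_rat {g h d : AddMonoidAlgebra K ℚ} (hd : d ≠ 0) (hh : h ≠ 0)
    (H : ∀ n : ℕ, h ^ n ∣ d * g ^ n) : h ∣ g := by
  classical
  obtain ⟨N, hN, hs⟩ := exists_pos_forall_mul_mem_range
    (g.coeff.support ∪ h.coeff.support ∪ d.coeff.support)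
  have hN' : (N : ℚ) ≠ 0 := by exact_mod_cast hN.ne'
  -- `i z = z / N`: all exponents of `g`, `h`, `d` lie in the image, so the problem descends to the
  -- principal ideal domain `K[ℤ]`.
  let i : ℤ →+ ℚ := (AddMonoidHom.mulRight (N : ℚ)⁻¹).comp (Int.castAddHom ℚ)
  have hi : Function.Injective i := fun a b hab => by
    have : (a : ℚ) * (N : ℚ)⁻¹ = b * (N : ℚ)⁻¹ := hab
    exact_mod_cast mul_right_cancel₀ (inv_ne_zero hN') this
  have key : ∀ f : AddMonoidAlgebra K ℚ,
      f.coeff.support ⊆ g.coeff.support ∪ h.coeff.support ∪ d.coeff.support →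
      ∃ f', mapDomainRingHom K i f' = f := by
    refine fun f hf => ⟨comapDomain i hi f, mapDomain_comapDomain (fun q hq => ?_) hi⟩
    obtain ⟨z, hz⟩ := hs q (hf hq)
    exact ⟨z, by rw [hz, div_eq_mul_inv]; rfl⟩
  obtain ⟨g, rfl⟩ := key g (by intro; simp +contextual)
  obtain ⟨h, rfl⟩ := key h (by intro; simp +contextual)
  obtain ⟨d, rfl⟩ := key d (by intro; simp +contextual)
  have := isPrincipalIdealRing_int (K := K)
  refine map_dvd _ (dvd_of_forall_pow_dvd_mul_pow (d := d) ?_ ?_ fun n => ?_)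
  · rintro rfl; simp at hd
  · rintro rfl; simp at hh
  · have := H n
    rw [← map_pow, ← map_pow, ← map_mul] at this
    exact dvd_of_mapDomain_dvd_mapDomain i hi this

/-- Dividing by an element whose nonzero coefficients are units of `S` keeps coefficients in `S`. -/
theorem coeff_mem_of_mul [Add A] [UniqueSums A] (S : Subring K) {h : AddMonoidAlgebra K A}
    (h0 : h ≠ 0) (hh : ∀ a, h.coeff a ∈ S) (hinv : ∀ a, (h.coeff a)⁻¹ ∈ S)
    (w : AddMonoidAlgebra K A) (hw : ∀ a, (h * w).coeff a ∈ S) (a : A) : w.coeff a ∈ S := by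
  classical
  induction hn : w.coeff.support.card generalizing w a with
  | zero =>
    rw [Finset.card_eq_zero, Finsupp.support_eq_empty] at hn
    simp [hn, zero_mem]
  | succ n ih =>
    -- At a unique sum the coefficient of `h * w` is the single product `h_b w_c`; dividing by `h_b`
    -- puts `w_c` in `S`. The term at `c` is then removed from `w`, shrinking its support.
    obtain ⟨b, hb, c, hc, hu⟩ := UniqueSums.uniqueAdd_of_nonempty
      (A := h.coeff.support) (B := w.coeff.support)
      (Finsupp.support_nonempty_iff.2 (by simpa using h0)) (Finset.card_pos.1 (by omega))
    have hwc : w.coeff c ∈ S := by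
      have := mul_mem (hinv b) (hw (b + c))
      rwa [coeff_mul_add_of_uniqueAdd hu,
        inv_mul_cancel_left₀ (Finsupp.mem_support_iff.1 hb)] at this
    have hsingle : ∀ x, (single c (w.coeff c)).coeff x ∈ S := fun x => by
      rw [coeff_single, Finsupp.single_apply]
      split_ifs
      exacts [hwc, zero_mem _]
    have hx := single_add_erase c w
    have herase : ∀ x, (w.erase c).coeff x ∈ S := by
      refine fun x => ih (w.erase c) (fun y => ?_) x ?_
      · rw [eq_sub_of_add_eq' hx, mul_sub, sub_eq_add_neg, coeff_add, Finsupp.add_apply,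
          ← mul_neg]
        refine add_mem (hw y) (coeff_mul_mem S.toAddSubgroup fun p q _ => ?_)
        exact S.mul_mem (hh p) (S.neg_mem (hsingle q))
      · rw [coeff_erase, Finsupp.support_erase, Finset.card_erase_of_mem hc, hn]
        rfl
    rw [← hx]
    exact add_mem (hsingle a) (herase a)

/-! ### Contents and the Dedekind–Mertens inequality. -/

section Content

variable (R) in
/-- The `R`-submodule of `K` generated by the coefficients of an element of `K[A]`. -/
def content (f : AddMonoidAlgebra K A) : Submodule R K := Submodule.span R (Set.range f.coeff)

theorem coeff_mem_content (f : AddMonoidAlgebra K A) (a : A) : f.coeff a ∈ content R f :=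
  Submodule.subset_span ⟨a, rfl⟩

theorem content_le {f : AddMonoidAlgebra K A} {P : Submodule R K} :
    content R f ≤ P ↔ ∀ a, f.coeff a ∈ P := by
  rw [content, Submodule.span_le, Set.range_subset_iff]
  rfl

theorem content_fg (f : AddMonoidAlgebra K A) : (content R f).FG :=
  Submodule.fg_span f.coeff.finite_range

theorem content_ne_bot {f : AddMonoidAlgebra K A} (hf : f ≠ 0) : content R f ≠ ⊥ := by
  intro h
  refine hf (AddMonoidAlgebra.ext (Finsupp.ext fun a => ?_))
  have := coeff_mem_content (R := R) f a
  rwa [h, Submodule.mem_bot] at this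

theorem content_mul_le [Add A] (f g : AddMonoidAlgebra K A) :
    content R (f * g) ≤ content R f * content R g :=
  content_le.2 fun _ => coeff_mul_mem (content R f * content R g).toAddSubgroup fun a b _ =>
    Submodule.mul_mem_mul (coeff_mem_content f a) (coeff_mem_content g b)

theorem content_single_le (a : A) (r : K) :
    content R (single a r) ≤ Submodule.span R {r} := by
  classical
  refine content_le.2 fun b => ?_
  rw [coeff_single, Finsupp.single_apply]
  split_ifs
  exacts [Submodule.mem_span_singleton_self r, zero_mem _]

theorem content_add_le (f g : AddMonoidAlgebra K A) :
    content R (f + g) ≤ content R f ⊔ content R g :=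
  content_le.2 fun a => by
    rw [coeff_add, Finsupp.add_apply]
    exact Submodule.add_mem_sup (coeff_mem_content f a) (coeff_mem_content g a)

theorem content_neg (f : AddMonoidAlgebra K A) : content R (-f) = content R f := by
  have key : ∀ f : AddMonoidAlgebra K A, content R (-f) ≤ content R f := fun f =>
    content_le.2 fun a => neg_mem (coeff_mem_content f a)
  exact le_antisymm (key f) (by simpa using key (-f))

/-- Induction step for Dedekind–Mertens: with `f'` the rest of `f` after removing the term at `a`,
`f' g = f g - f_a g` bounds the content of `f' g`. -/
theorem content_mul_content_le_of_erase [AddCommMonoid A] (f g : AddMonoidAlgebra K A) (a : A)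
    {J : Submodule R K}
    (hJ : content R (f.erase a) * content R g * J ≤ content R (f.erase a * g) * J) :
    content R f * content R g * J ≤
      content R (f * g) * J ⊔ Submodule.span R {f.coeff a} * content R g * J := by
  have h1 : content R f ≤ Submodule.span R {f.coeff a} ⊔ content R (f.erase a) := by
    nth_rewrite 1 [← single_add_erase a f]
    exact (content_add_le _ _).trans (sup_le_sup_right (content_single_le _ _) _)
  have h2 : content R (f.erase a * g) ≤
      content R (f * g) ⊔ Submodule.span R {f.coeff a} * content R g := by
    rw [eq_sub_of_add_eq' (single_add_erase a f), sub_mul, sub_eq_add_neg]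
    refine (content_add_le _ _).trans (sup_le_sup_left ?_ _)
    rw [content_neg]
    exact (content_mul_le _ _).trans (mul_le_mul' (content_single_le _ _) le_rfl)
  calc content R f * content R g * J
      ≤ (Submodule.span R {f.coeff a} ⊔ content R (f.erase a)) * content R g * J := by gcongr
    _ = Submodule.span R {f.coeff a} * content R g * J ⊔
          content R (f.erase a) * content R g * J := by
        rw [Submodule.sup_mul, Submodule.sup_mul]
    _ ≤ _ := by
        refine sup_le le_sup_right (hJ.trans ?_)
        rw [← Submodule.sup_mul]
        gcongr

/-- A weak form of the Dedekind–Mertens lemma for group algebras. -/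
theorem exists_content_mul_content_mul_le [AddCommMonoid A] [UniqueSums A]
    (f g : AddMonoidAlgebra K A) : ∃ J : Submodule R K, J.FG ∧ J ≠ ⊥ ∧
      content R f * content R g * J ≤ content R (f * g) * J := by
  classical
  induction hn : f.coeff.support.card + g.coeff.support.card using Nat.strong_induction_on
    generalizing f g with
  | _ n ih =>
  by_cases hf : f = 0
  · have : content R f = ⊥ := le_bot_iff.1 (content_le.2 (by simp [hf]))
    exact ⟨Submodule.span R {1}, Submodule.fg_span_singleton 1, by simp, by simp [this]⟩
  by_cases hg : g = 0
  · have : content R g = ⊥ := le_bot_iff.1 (content_le.2 (by simp [hg]))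
    exact ⟨Submodule.span R {1}, Submodule.fg_span_singleton 1, by simp, by simp [this]⟩
  -- The unique sum makes `f_a g_b` a coefficient of `f * g`. The induction hypothesis is used
  -- twice: removing `a` from `f`, and removing `b` from `g`.
  obtain ⟨a, ha, b, hb, hu⟩ := UniqueSums.uniqueAdd_of_nonempty
    (A := f.coeff.support) (B := g.coeff.support)
    (Finsupp.support_nonempty_iff.2 (by simpa using hf))
    (Finsupp.support_nonempty_iff.2 (by simpa using hg))
  have ha' := Finset.card_pos.2 ⟨a, ha⟩
  have hb' := Finset.card_pos.2 ⟨b, hb⟩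
  obtain ⟨J, hJ, hJ0, h1⟩ := ih _ (by
    rw [coeff_erase, Finsupp.support_erase, Finset.card_erase_of_mem ha]; omega) (f.erase a) g rfl
  obtain ⟨J', hJ', hJ0', h2⟩ := ih _ (by
    rw [coeff_erase, Finsupp.support_erase, Finset.card_erase_of_mem hb]; omega) (g.erase b) f rfl
  have h1 := content_mul_content_le_of_erase f g a h1
  have h2 := content_mul_content_le_of_erase g f b h2
  rw [mul_comm g f] at h2
  have hPQ : Submodule.span R {f.coeff a} * Submodule.span R {g.coeff b} ≤ content R (f * g) := by
    rw [Submodule.span_mul_span, Set.singleton_mul_singleton, Submodule.span_singleton_le_iff_mem,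
      ← coeff_mul_add_of_uniqueAdd hu]
    exact coeff_mem_content _ _
  have hA := content_fg (R := R) f
  have hB := content_fg (R := R) g
  have hA0 := content_ne_bot (R := R) hf
  have hB0 := content_ne_bot (R := R) hg
  have hPA : Submodule.span R {f.coeff a} ≤ content R f :=
    (Submodule.span_singleton_le_iff_mem _ _).2 (coeff_mem_content f a)
  generalize content R f = F at *
  generalize content R g = G at *
  generalize content R (f * g) = D at *
  generalize Submodule.span R {f.coeff a} = P at *
  generalize Submodule.span R {g.coeff b} = Q at *
  -- The extra factor `F * G` allows both inductive bounds to be multiplied. Every term of the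
  -- expansion then contains `D`, except one containing `P * Q ≤ D`.
  refine ⟨F * G * (J * J'), (hA.mul hB).mul (hJ.mul hJ'), ?_, ?_⟩
  · exact mul_ne_zero (mul_ne_zero hA0 hB0) (mul_ne_zero hJ0 hJ0')
  calc F * G * (F * G * (J * J')) = F * G * J * (F * G * J') := by ring
    _ ≤ (D * J ⊔ P * G * J) * (F * G * J') := by gcongr
    _ = D * (F * G * (J * J')) ⊔ P * G * J * (G * F * J') := by
        rw [Submodule.sup_mul]; congr 1 <;> ring
    _ ≤ D * (F * G * (J * J')) ⊔ P * G * J * (D * J' ⊔ Q * F * J') := by gcongr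
    _ = D * (F * G * (J * J')) ⊔ (D * (P * G * (J * J')) ⊔ P * Q * (F * G * (J * J'))) := by
        rw [Submodule.mul_sup]; congr 2 <;> ring
    _ ≤ D * (F * G * (J * J')) := by
        refine sup_le le_rfl (sup_le ?_ ?_) <;> gcongr

/-- The inequality survives multiplying `J` by another module, so the product of the individual
multipliers serves all `g i` at once. -/
theorem exists_forall_content_mul_content_mul_le [AddCommMonoid A] [UniqueSums A] {ι : Type*}
    (f : AddMonoidAlgebra K A) (g : ι → AddMonoidAlgebra K A) (s : Finset ι) :
    ∃ J : Submodule R K, J.FG ∧ J ≠ ⊥ ∧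
      ∀ i ∈ s, content R f * content R (g i) * J ≤ content R (f * g i) * J := by
  classical
  induction s using Finset.induction_on with
  | empty => exact ⟨Submodule.span R {1}, Submodule.fg_span_singleton 1, by simp, by simp⟩
  | insert j s hj ih =>
    obtain ⟨J, hJ, hJ0, h⟩ := ih
    obtain ⟨J', hJ', hJ0', h'⟩ := exists_content_mul_content_mul_le (R := R) f (g j)
    refine ⟨J * J', hJ.mul hJ', mul_ne_zero hJ0 hJ0', fun i hi => ?_⟩
    rcases Finset.mem_insert.1 hi with rfl | hi
    · rw [mul_comm J, ← mul_assoc, ← mul_assoc]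
      gcongr
    · rw [← mul_assoc, ← mul_assoc]
      exact mul_le_mul' (h i hi) le_rfl

end Content

end AddMonoidAlgebra

/-! ### Torsion-free abelian groups. -/

section TorsionFree

/-- The group embeds in its divisible hull, a `ℚ`-vector space. -/
theorem AddCommGroup.uniqueSums_of_isAddTorsionFree (G : Type*) [AddCommGroup G]
    [IsAddTorsionFree G] : UniqueSums G :=
  have : TwoUniqueSums G := TwoUniqueSums.of_injective_addHom
    (DivisibleHull.coeAddMonoidHom G).toAddHom DivisibleHull.coe_injective inferInstance
  inferInstance

/-- Finitely many elements of a torsion-free abelian group are separated by a homomorphism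
to `ℚ`. -/
theorem AddCommGroup.exists_injOn_rat {G : Type*} [AddCommGroup G] [IsAddTorsionFree G]
    (s : Finset G) : ∃ f : G →+ ℚ, Set.InjOn f s := by
  classical
  let ι := {p : s × s // p.1 ≠ p.2}
  -- A single functional is nonzero on each of the finitely many nonzero differences of elements of
  -- `s`.
  obtain ⟨f, hf⟩ := Module.exists_dual_forall_apply_ne_zero (K := ℚ)
    (fun p : ι => ((p.1.1.1 - p.1.2.1 : G) : DivisibleHull G)) (fun p h => p.2 (by
      apply Subtype.ext
      exact sub_eq_zero.1 (DivisibleHull.coe_injective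
        (h.trans (map_zero (DivisibleHull.coeAddMonoidHom G)).symm))))
  refine ⟨f.toAddMonoidHom.comp (DivisibleHull.coeAddMonoidHom G), fun a ha b hb hab => ?_⟩
  by_contra hne
  apply hf ⟨⟨⟨a, ha⟩, ⟨b, hb⟩⟩, fun h => hne (congrArg Subtype.val h)⟩
  have : ((a - b : G) : DivisibleHull G) = DivisibleHull.coeAddMonoidHom G (a - b) := rfl
  rw [this, map_sub, map_sub]
  exact sub_eq_zero.2 hab

end TorsionFree

/-! ### Augmentation and change of exponents. -/

namespace AddMonoidAlgebra

variable {K A B : Type*} [Field K]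

/-- The augmentation map of a group algebra: the sum of all coefficients. -/
noncomputable def augmentation [AddMonoid A] : AddMonoidAlgebra K A →+* K :=
  (AddMonoidAlgebra.lift K K A 1).toRingHom

theorem augmentation_apply [AddMonoid A] (f : AddMonoidAlgebra K A) :
    augmentation f = ∑ a ∈ f.coeff.support, f.coeff a := by
  simp [augmentation, AddMonoidAlgebra.lift_apply, Finsupp.sum]

@[simp]
theorem augmentation_single [AddMonoid A] (a : A) (r : K) : augmentation (single a r) = r := by
  simp [augmentation, AddMonoidAlgebra.lift_apply]

theorem augmentation_mem_content {R : Type*} [CommRing R] [Algebra R K] [AddMonoid A]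
    (f : AddMonoidAlgebra K A) : augmentation f ∈ content R f := by
  rw [augmentation_apply]
  exact sum_mem fun a _ => coeff_mem_content f a

theorem augmentation_mapDomain [AddMonoid A] [AddMonoid B] (i : A →+ B)
    (f : AddMonoidAlgebra K A) : augmentation (mapDomain i f) = augmentation f := by
  induction f using induction_linear with
  | zero => simp
  | add p q hp hq => rw [mapDomain_add, map_add, hp, hq, map_add]
  | single a r => simp

theorem coeff_mapDomain_mem [Add A] [Add B] (S : AddSubgroup K) (i : A → B)
    {f : AddMonoidAlgebra K A} (hf : ∀ a, f.coeff a ∈ S) (b : B) : (mapDomain i f).coeff b ∈ S := by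
  classical
  change Finsupp.mapDomain i f.coeff b ∈ S
  rw [Finsupp.mapDomain, Finsupp.sum_apply]
  refine sum_mem fun a _ => ?_
  dsimp only
  rw [Finsupp.single_apply]
  split_ifs
  exacts [hf a, zero_mem _]

/-- Injectivity on the support prevents coefficients from being added together. Homogeneous
coefficients thus stay homogeneous, and the nonzero ones stay invertible in `R_H`. -/
theorem exists_coeff_mapDomain_eq [Add A] [Add B] (i : A → B)
    {f : AddMonoidAlgebra K A} (hf : Set.InjOn i f.coeff.support) (b : B) :
    (mapDomain i f).coeff b = 0 ∨ ∃ a, (mapDomain i f).coeff b = f.coeff a := by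
  classical
  rw [or_iff_not_imp_left]
  intro hb
  have hb' := Finsupp.mapDomain_support (Finsupp.mem_support_iff.2 hb)
  obtain ⟨a, ha, rfl⟩ := Finset.mem_image.1 hb'
  exact ⟨a, Finsupp.mapDomain_apply' _ _ subset_rfl hf ha⟩

end AddMonoidAlgebra

/-! ### The graded ring `R_H` and its complete integral closedness. -/

section HomogeneousQuotient

variable {Γ R K : Type*} [AddCancelCommMonoid Γ] [DecidableEq Γ] [CommRing R] [IsDomain R]
variable (𝒜 : Γ → AddSubgroup R) [GradedRing 𝒜]
variable [Field K] [Algebra R K] [IsFractionRing R K]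

open AddMonoidAlgebra Algebra

local notation "C" => homogeneousQuotientComponent 𝒜 K

theorem one_mem_homogeneousQuotientComponent : (1 : K) ∈ C 0 :=
  Or.inr ⟨0, 0, 1, 1, SetLike.one_mem_graded 𝒜, SetLike.one_mem_graded 𝒜, one_ne_zero, by simp,
    by simp⟩

theorem mul_mem_homogeneousQuotientComponent {α β : GrothendieckAddGroup Γ} {x y : K}
    (hx : x ∈ C α) (hy : y ∈ C β) : x * y ∈ C (α + β) := by
  rcases hx with rfl | ⟨γ, δ, a, b, ha, hb, hb0, rfl, rfl⟩
  · rw [zero_mul]; exact zero_mem _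
  rcases hy with rfl | ⟨γ', δ', a', b', ha', hb', hb0', rfl, rfl⟩
  · rw [mul_zero]; exact zero_mem _
  refine Or.inr ⟨γ + γ', δ + δ', a * a', b * b', SetLike.mul_mem_graded ha ha',
    SetLike.mul_mem_graded hb hb', mul_ne_zero hb0 hb0', ?_, ?_⟩
  · rw [map_add, map_add, add_sub_add_comm]
  · rw [map_mul, map_mul, div_mul_div_comm]

theorem inv_mem_homogeneousQuotientComponent {α : GrothendieckAddGroup Γ} {x : K}
    (hx : x ∈ C α) : x⁻¹ ∈ C (-α) := by
  rcases hx with rfl | ⟨γ, δ, a, b, ha, hb, hb0, rfl, rfl⟩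
  · rw [inv_zero]; exact zero_mem _
  by_cases ha0 : a = 0
  · simp [ha0, zero_mem]
  · exact Or.inr ⟨δ, γ, b, a, hb, ha, ha0, by rw [neg_sub], by rw [inv_div]⟩

theorem algebraMap_mem_homogeneousQuotientComponent {γ : Γ} {a : R} (ha : a ∈ 𝒜 γ) :
    algebraMap R K a ∈ C (GrothendieckAddGroup.of γ) :=
  Or.inr ⟨γ, 0, a, 1, ha, SetLike.one_mem_graded 𝒜, one_ne_zero, by simp, by simp⟩

/-- Finitely many homogeneous fractions have a homogeneous common denominator. -/
theorem exists_homogeneous_common_denominator {ι : Type*} (s : Finset ι) (x : ι → K)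
    (α : ι → GrothendieckAddGroup Γ) (hx : ∀ i ∈ s, x i ∈ C (α i)) :
    ∃ δ, ∃ b ∈ 𝒜 δ, b ≠ 0 ∧ ∀ i ∈ s, x i ≠ 0 → ∃ γ, ∃ a ∈ 𝒜 γ,
      algebraMap R K b * x i = algebraMap R K a ∧
      GrothendieckAddGroup.of γ = α i + GrothendieckAddGroup.of δ := by
  classical
  induction s using Finset.induction_on with
  | empty => exact ⟨0, 1, SetLike.one_mem_graded 𝒜, one_ne_zero, by simp⟩
  | insert j s hj ih =>
    obtain ⟨δ, b, hb, hb0, h⟩ := ih fun i hi => hx i (Finset.mem_insert_of_mem hi)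
    rcases hx j (Finset.mem_insert_self j s) with h0 | ⟨γ', δ', a', b', ha', hb', hb0', e, e'⟩
    · refine ⟨δ, b, hb, hb0, fun i hi hi0 => ?_⟩
      rcases Finset.mem_insert.1 hi with rfl | hi
      · exact absurd h0 hi0
      · exact h i hi hi0
    · refine ⟨δ + δ', b * b', SetLike.mul_mem_graded hb hb', mul_ne_zero hb0 hb0',
        fun i hi hi0 => ?_⟩
      have hK : algebraMap R K b' ≠ 0 := by simpa using hb0'
      rcases Finset.mem_insert.1 hi with rfl | hi
      · refine ⟨δ + γ', b * a', SetLike.mul_mem_graded hb ha', ?_, ?_⟩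
        · rw [e', map_mul, map_mul]
          field_simp
        · rw [← e, map_add, map_add]
          abel
      · obtain ⟨γ, a, ha, e1, e2⟩ := h i hi hi0
        refine ⟨γ + δ', a * b', SetLike.mul_mem_graded ha hb', ?_, ?_⟩
        · rw [map_mul, map_mul, ← e1]
          ring
        · rw [map_add, map_add, e2, add_assoc]

/-- The subring of the group algebra `K[⟨Γ⟩]` whose elements have `α`-th coefficient
in `(R_H)_α`. -/
def homogeneousLift : Subring (AddMonoidAlgebra K (GrothendieckAddGroup Γ)) where
  carrier := {w | ∀ α, w.coeff α ∈ C α}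
  zero_mem' := fun α => zero_mem _
  one_mem' := fun α => by
    classical
    rw [one_def, coeff_single, Finsupp.single_apply]
    split_ifs with h
    · exact h ▸ one_mem_homogeneousQuotientComponent 𝒜
    · exact zero_mem _
  add_mem' := fun hf hg α => add_mem (hf α) (hg α)
  neg_mem' := fun hf α => neg_mem (hf α)
  mul_mem' := fun hf hg α => coeff_mul_mem (C α) fun β γ h =>
    h ▸ mul_mem_homogeneousQuotientComponent 𝒜 (hf β) (hg γ)

local notation "L" => homogeneousLift (K := K) 𝒜

theorem single_mem_homogeneousLift {α : GrothendieckAddGroup Γ} {x : K} (hx : x ∈ C α) :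
    single α x ∈ L := fun β => by
  classical
  rw [coeff_single, Finsupp.single_apply]
  split_ifs with h
  · exact h ▸ hx
  · exact zero_mem _

/-- This is the directness of the sum of the `(R_H)_α`. After clearing a homogeneous denominator,
distinct `α` give numerators of distinct degrees in `Γ`, which are separated by projecting in `R`.
-/
theorem eq_zero_of_augmentation_eq_zero {w : AddMonoidAlgebra K (GrothendieckAddGroup Γ)}
    (hw : w ∈ L) (h : augmentation w = 0) : w = 0 := by
  classical
  obtain ⟨δ, b, hb, hb0, H⟩ := exists_homogeneous_common_denominator 𝒜 w.coeff.support w.coeff id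
    fun α _ => hw α
  choose! γ a ha hba hγ using fun α hα => H α hα (Finsupp.mem_support_iff.1 hα)
  have hbK : algebraMap R K b ≠ 0 := by simpa using hb0
  have hsum : ∑ α ∈ w.coeff.support, a α = 0 := by
    apply IsFractionRing.injective R K
    rw [map_zero, map_sum, ← Finset.sum_congr rfl hba, ← Finset.mul_sum, ← augmentation_apply, h,
      mul_zero]
  by_contra hw0
  obtain ⟨α, hα⟩ := Finsupp.support_nonempty_iff.2 (mt coeff_eq_zero.1 hw0)
  have hproj := congrArg (GradedRing.proj 𝒜 (γ α)) hsum
  rw [map_sum, map_zero, Finset.sum_eq_single α] at hproj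
  · rw [GradedRing.proj_apply, DirectSum.decompose_of_mem_same 𝒜 (ha α hα)] at hproj
    have := hba α hα
    rw [hproj, map_zero] at this
    exact mul_ne_zero hbK (Finsupp.mem_support_iff.1 hα) this
  · intro β hβ hne
    rw [GradedRing.proj_apply, DirectSum.decompose_of_mem_ne 𝒜 (ha β hβ)]
    intro e
    apply hne
    have h1 := hγ α hα
    rw [← e, hγ β hβ] at h1
    exact add_right_cancel h1
  · exact fun h => absurd hα h

theorem eq_of_augmentation_eq {w w' : AddMonoidAlgebra K (GrothendieckAddGroup Γ)}
    (hw : w ∈ L) (hw' : w' ∈ L) (h : augmentation w = augmentation w') : w = w' :=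
  sub_eq_zero.1 (eq_zero_of_augmentation_eq_zero 𝒜 (sub_mem hw hw') (by rw [map_sub, h, sub_self]))

open Classical in
/-- The element of `K[⟨Γ⟩]` whose coefficients are the homogeneous components of `r`. -/
noncomputable def gradedLift (r : R) : AddMonoidAlgebra K (GrothendieckAddGroup Γ) :=
  ∑ γ ∈ (DirectSum.decompose 𝒜 r).support,
    single (GrothendieckAddGroup.of γ) (algebraMap R K (DirectSum.decompose 𝒜 r γ))

theorem gradedLift_mem (r : R) : gradedLift 𝒜 r ∈ L :=
  sum_mem fun _ _ => single_mem_homogeneousLift 𝒜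
    (algebraMap_mem_homogeneousQuotientComponent 𝒜 (SetLike.coe_mem _))

set_option linter.unusedSectionVars false in
@[simp]
theorem augmentation_gradedLift (r : R) :
    augmentation (gradedLift (K := K) 𝒜 r) = algebraMap R K r := by
  classical
  rw [gradedLift, map_sum]
  simp only [augmentation_single]
  rw [← map_sum, DirectSum.sum_support_decompose]

/-- The homogeneous quotient field `R_H`. -/
noncomputable def homogeneousQuotient : Subring K := (homogeneousLift 𝒜).map augmentation

theorem mem_homogeneousQuotient_of_mem {α : GrothendieckAddGroup Γ} {x : K} (hx : x ∈ C α) :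
    x ∈ homogeneousQuotient (K := K) 𝒜 :=
  ⟨single α x, single_mem_homogeneousLift 𝒜 hx, augmentation_single α x⟩

/-- `R_H` is completely integrally closed in `K`. -/
theorem mem_homogeneousQuotient_of_forall_pow_mul_mem [IsAddTorsionFree Γ] {x : K} {r : R}
    (hr : r ≠ 0) (H : ∀ n : ℕ, x ^ n * algebraMap R K r ∈ homogeneousQuotient (K := K) 𝒜) :
    x ∈ homogeneousQuotient (K := K) 𝒜 := by
  obtain ⟨g, h, hh, rfl⟩ := IsFractionRing.div_surjective (A := R) x
  have hh0 : h ≠ 0 := nonZeroDivisors.ne_zero hh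
  have hK : algebraMap R K h ≠ 0 := by simpa using hh0
  -- Only the exponents of `h` need to stay distinct in `ℚ`, since only the coefficients of `h` get
  -- inverted.
  obtain ⟨ψ, hψ⟩ := AddCommGroup.exists_injOn_rat (gradedLift (K := K) 𝒜 h).coeff.support
  let Ψ := mapDomainRingHom K ψ
  have haug : ∀ f, augmentation (Ψ f) = augmentation f := augmentation_mapDomain ψ
  have hne : ∀ t : R, t ≠ 0 → Ψ (gradedLift 𝒜 t) ≠ 0 := fun t ht e => by
    have := haug (gradedLift 𝒜 t)
    rw [e, map_zero, augmentation_gradedLift] at this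
    exact ht (by simpa using this.symm)
  have hdvd : Ψ (gradedLift 𝒜 h) ∣ Ψ (gradedLift 𝒜 g) := by
    refine dvd_of_forall_pow_dvd_mul_pow_rat (hne r hr) (hne h hh0) fun n => ?_
    obtain ⟨ζ, hζ, e⟩ := H n
    refine ⟨Ψ ζ, ?_⟩
    rw [← map_pow, ← map_pow, ← map_mul, ← map_mul]
    congr 1
    -- The identity `r g^n = h^n (x^n r)` in `K` lifts to `K[⟨Γ⟩]` by uniqueness of lifts, and only
    -- then is mapped to `K[ℚ]`.
    refine eq_of_augmentation_eq 𝒜 (mul_mem (gradedLift_mem 𝒜 r) (pow_mem (gradedLift_mem 𝒜 g) n))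
      (mul_mem (pow_mem (gradedLift_mem 𝒜 h) n) hζ) ?_
    simp only [map_mul, map_pow, e, augmentation_gradedLift]
    rw [div_pow]
    field_simp
  obtain ⟨w, hw⟩ := hdvd
  have hcoeff : ∀ (t : R) a, (gradedLift 𝒜 t).coeff a ∈ homogeneousQuotient (K := K) 𝒜 :=
    fun t a => mem_homogeneousQuotient_of_mem 𝒜 (gradedLift_mem 𝒜 t a)
  have hwc := coeff_mem_of_mul (homogeneousQuotient (K := K) 𝒜) (hne h hh0)
    (coeff_mapDomain_mem (homogeneousQuotient (K := K) 𝒜).toAddSubgroup ψ (hcoeff h))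
    (fun a => by
      rcases exists_coeff_mapDomain_eq ψ hψ a with e | ⟨b, e⟩
      · change ((mapDomain ψ _).coeff a)⁻¹ ∈ _
        rw [e, inv_zero]
        exact zero_mem _
      · change ((mapDomain ψ _).coeff a)⁻¹ ∈ _
        rw [e]
        exact mem_homogeneousQuotient_of_mem 𝒜
          (inv_mem_homogeneousQuotientComponent 𝒜 (gradedLift_mem 𝒜 h b)))
    w (by
      rw [← hw]
      exact coeff_mapDomain_mem (homogeneousQuotient (K := K) 𝒜).toAddSubgroup ψ (hcoeff g))
  -- The quotient `w` lives in `K[ℚ]` and carries no `⟨Γ⟩`-grading, but its augmentation is a sum of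
  -- coefficients in `R_H`.
  have hx : algebraMap R K g / algebraMap R K h = augmentation w := by
    rw [div_eq_iff hK, ← augmentation_gradedLift (K := K) 𝒜 g, ← haug, hw, map_mul, haug,
      augmentation_gradedLift, mul_comm]
  rw [hx, augmentation_apply]
  exact sum_mem fun a _ => hwc a

end HomogeneousQuotient

/-! ### Homogeneous submodules and homogeneous finite generation. -/

section HomogeneousSubmodules

variable {Γ R K : Type*} [AddCancelCommMonoid Γ] [DecidableEq Γ] [CommRing R] [IsDomain R]
variable (𝒜 : Γ → AddSubgroup R) [GradedRing 𝒜]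
variable [Field K] [Algebra R K] [IsFractionRing R K]

open AddMonoidAlgebra Algebra

local notation "C" => homogeneousQuotientComponent 𝒜 K

/-- The coefficients of `ζ` are the homogeneous components of `z`, so homogeneity becomes a
containment of contents. -/
theorem isHomogeneousSubmodule_iff {M : Submodule R K} :
    IsHomogeneousSubmodule 𝒜 M ↔
      ∀ z ∈ M, ∃ ζ ∈ homogeneousLift 𝒜, augmentation ζ = z ∧ content R ζ ≤ M := by
  constructor
  · intro h z hz
    have hz' : z ∈ M.toAddSubgroup := hz
    rw [h] at hz'
    induction hz' using AddSubgroup.iSup_induction' with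
    | hp α x hx =>
      exact ⟨single α x, single_mem_homogeneousLift 𝒜 hx.2, augmentation_single α x,
        (content_single_le α x).trans ((Submodule.span_singleton_le_iff_mem _ _).2 hx.1)⟩
    | h1 => exact ⟨0, zero_mem _, map_zero _, content_le.2 fun _ => zero_mem _⟩
    | hadd x y hx hy ihx ihy =>
      rw [← h] at hx hy
      obtain ⟨ζ, hζ, rfl, h1⟩ := ihx hx
      obtain ⟨ξ, hξ, rfl, h2⟩ := ihy hy
      exact ⟨ζ + ξ, add_mem hζ hξ, map_add _ _ _, (content_add_le _ _).trans (sup_le h1 h2)⟩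
  · intro h
    refine le_antisymm (fun z hz => ?_) (iSup_le fun α => inf_le_left)
    obtain ⟨ζ, hζ, rfl, hM⟩ := h z hz
    rw [augmentation_apply]
    exact sum_mem fun α _ => AddSubgroup.mem_iSup_of_mem α ⟨content_le.1 hM α, hζ α⟩

/-- An `R`-submodule of `R_H` generated by finitely many homogeneous elements. -/
def IsHomogeneouslyFG (F : Submodule R K) : Prop :=
  ∃ T : Finset K, (∀ t ∈ T, ∃ α, t ∈ C α) ∧ Submodule.span R (T : Set K) = F

namespace IsHomogeneouslyFG

variable {𝒜}

theorem fg {F : Submodule R K} (hF : IsHomogeneouslyFG 𝒜 F) : F.FG :=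
  let ⟨T, _, hT⟩ := hF
  ⟨T, hT⟩

theorem bot : IsHomogeneouslyFG 𝒜 (⊥ : Submodule R K) := ⟨∅, by simp, by simp⟩

theorem span_one : IsHomogeneouslyFG 𝒜 (Submodule.span R {1} : Submodule R K) :=
  ⟨{1}, by simpa using ⟨0, one_mem_homogeneousQuotientComponent 𝒜⟩, by simp⟩

theorem sup {F F' : Submodule R K} (hF : IsHomogeneouslyFG 𝒜 F) (hF' : IsHomogeneouslyFG 𝒜 F') :
    IsHomogeneouslyFG 𝒜 (F ⊔ F') := by
  classical
  obtain ⟨T, hT, rfl⟩ := hF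
  obtain ⟨T', hT', rfl⟩ := hF'
  refine ⟨T ∪ T', fun t ht => ?_, by rw [Finset.coe_union, Submodule.span_union]⟩
  rcases Finset.mem_union.1 ht with h | h
  exacts [hT t h, hT' t h]

theorem mul {F F' : Submodule R K} (hF : IsHomogeneouslyFG 𝒜 F) (hF' : IsHomogeneouslyFG 𝒜 F') :
    IsHomogeneouslyFG 𝒜 (F * F') := by
  classical
  obtain ⟨T, hT, rfl⟩ := hF
  obtain ⟨T', hT', rfl⟩ := hF'
  refine ⟨T * T', fun t ht => ?_, by rw [Finset.coe_mul, Submodule.span_mul_span]⟩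
  obtain ⟨u, hu, v, hv, rfl⟩ := Finset.mem_mul.1 ht
  obtain ⟨α, hα⟩ := hT u hu
  obtain ⟨β, hβ⟩ := hT' v hv
  exact ⟨α + β, mul_mem_homogeneousQuotientComponent 𝒜 hα hβ⟩

theorem content {f : AddMonoidAlgebra K (GrothendieckAddGroup Γ)} (hf : f ∈ homogeneousLift 𝒜) :
    IsHomogeneouslyFG 𝒜 (content R f) := by
  refine ⟨f.coeff.finite_range.toFinset, fun t ht => ?_, by rw [Set.Finite.coe_toFinset]; rfl⟩
  rw [Set.Finite.mem_toFinset] at ht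
  obtain ⟨α, rfl⟩ := ht
  exact ⟨α, hf α⟩

theorem isHomogeneousFractionalIdeal {F : Submodule R K} (hF : IsHomogeneouslyFG 𝒜 F) :
    IsHomogeneousFractionalIdeal 𝒜 F := by
  obtain ⟨T, hT, rfl⟩ := hF
  choose! α hα using hT
  obtain ⟨δ, b, hb, hb0, H⟩ := exists_homogeneous_common_denominator 𝒜 T id α hα
  have H' : ∀ t ∈ T, ∃ a, SetLike.IsHomogeneousElem 𝒜 a ∧
      algebraMap R K b * t = algebraMap R K a := by
    intro t ht
    by_cases h0 : t = 0
    · exact ⟨0, ⟨0, zero_mem _⟩, by simp [h0]⟩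
    · obtain ⟨γ, a, ha, h, -⟩ := H t ht h0
      exact ⟨a, ⟨γ, ha⟩, h⟩
  -- The ideal is generated by the numerators over the common homogeneous denominator `b`.
  refine ⟨b, hb0, ⟨δ, hb⟩, Ideal.span {a | ∃ t ∈ T, algebraMap R K b * t = algebraMap R K a},
    Ideal.homogeneous_span 𝒜 _ ?_, ?_⟩
  · rintro a ⟨t, ht, e⟩
    obtain ⟨a', ha', e'⟩ := H' t ht
    rwa [IsFractionRing.injective R K (e.symm.trans e')]
  · rw [IsLocalization.coeSubmodule_span, Submodule.smul_span]
    congr 1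
    ext z
    constructor
    · rintro ⟨t, ht, rfl⟩
      obtain ⟨a, -, e⟩ := H' t ht
      exact ⟨a, ⟨t, ht, e⟩, by rw [← e, ← Algebra.smul_def]⟩
    · rintro ⟨a, ⟨t, ht, e⟩, rfl⟩
      exact ⟨t, ht, by rw [← e, ← Algebra.smul_def]⟩

end IsHomogeneouslyFG

variable {𝒜}

/-- With `s x = r ∈ I`, the generators are the components of `r` divided by `s`; they stay in `E`
because `I` is homogeneous. -/
theorem IsHomogeneousFractionalIdeal.exists_mem {E : Submodule R K}
    (hE : IsHomogeneousFractionalIdeal 𝒜 E) {x : K} (hx : x ∈ E) :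
    ∃ F : Submodule R K, IsHomogeneouslyFG 𝒜 F ∧ F ≤ E ∧ x ∈ F := by
  classical
  obtain ⟨s, hs0, ⟨σ, hσ⟩, I, hI, e⟩ := hE
  have hs : algebraMap R K s ≠ 0 := by simpa using hs0
  obtain ⟨r, hr, hrx⟩ := (IsLocalization.mem_coeSubmodule K I).1
    (e ▸ Submodule.smul_mem_pointwise_smul x s E hx)
  rw [Algebra.smul_def] at hrx
  refine ⟨Submodule.span R ((DirectSum.decompose 𝒜 r).support.image fun γ =>
      algebraMap R K (DirectSum.decompose 𝒜 r γ) / algebraMap R K s : Finset K),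
    ⟨_, fun t ht => ?_, rfl⟩, Submodule.span_le.2 fun t ht => ?_, ?_⟩
  · obtain ⟨γ, -, rfl⟩ := Finset.mem_image.1 ht
    exact ⟨_, Or.inr ⟨γ, σ, _, s, SetLike.coe_mem _, hσ, hs0, rfl, rfl⟩⟩
  · obtain ⟨γ, -, rfl⟩ := Finset.mem_image.1 ht
    have h1 : algebraMap R K (DirectSum.decompose 𝒜 r γ) ∈ s • E := by
      rw [e]
      exact (IsLocalization.mem_coeSubmodule K I).2 ⟨_, hI γ hr, rfl⟩
    obtain ⟨y, hy, hy'⟩ := (Submodule.mem_smul_pointwise_iff_exists _ _ _).1 h1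
    rw [← hy', Algebra.smul_def]
    rwa [mul_div_cancel_left₀ y hs]
  · have h2 : x = ∑ γ ∈ (DirectSum.decompose 𝒜 r).support,
        algebraMap R K (DirectSum.decompose 𝒜 r γ) / algebraMap R K s := by
      rw [← Finset.sum_div, ← map_sum, DirectSum.sum_support_decompose, hrx,
        mul_div_cancel_left₀ x hs]
    rw [h2]
    exact sum_mem fun γ hγ => Submodule.subset_span (Finset.mem_image_of_mem _ hγ)

theorem IsHomogeneousFractionalIdeal.exists_fg_le {E : Submodule R K}
    (hE : IsHomogeneousFractionalIdeal 𝒜 E) {G : Submodule R K} (hG : G.FG) (hGE : G ≤ E) :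
    ∃ F : Submodule R K, IsHomogeneouslyFG 𝒜 F ∧ F ≤ E ∧ G ≤ F := by
  induction G, hG using Submodule.fg_induction with
  | singleton x =>
    obtain ⟨F, hF, hFE, hx⟩ := hE.exists_mem (hGE (Submodule.mem_span_singleton_self x))
    exact ⟨F, hF, hFE, (Submodule.span_singleton_le_iff_mem _ _).2 hx⟩
  | sup M N hM hN ihM ihN =>
    obtain ⟨F, hF, hFE, h⟩ := ihM (le_sup_left.trans hGE)
    obtain ⟨F', hF', hFE', h'⟩ := ihN (le_sup_right.trans hGE)
    exact ⟨F ⊔ F', hF.sup hF', sup_le hFE hFE', sup_le_sup h h'⟩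

/-- Up to a nonzero factor, a finitely generated submodule of `K` is generated by elements
of `R`. -/
theorem exists_ne_zero_span_mul_eq_span_algebraMap {G : Submodule R K} (hG : G.FG) :
    ∃ c : K, c ≠ 0 ∧ ∃ S : Finset R,
      Submodule.span R {c} * G = Submodule.span R (algebraMap R K '' S) := by
  classical
  obtain ⟨T, rfl⟩ := hG
  obtain ⟨b, hb⟩ := IsLocalization.exist_integer_multiples_of_finset (nonZeroDivisors R) T
  choose! a ha using hb
  refine ⟨algebraMap R K b, by simp, T.image a, ?_⟩
  rw [Submodule.span_mul_span, Finset.coe_image, Set.image_image, Set.singleton_mul]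
  congr 1
  refine Set.image_congr fun t ht => ?_
  rw [ha t ht, Algebra.smul_def]

/-! ### Components of elements of `E^{⋆_a}`. -/

namespace SemistarOperation

open NonzeroSubmodule

variable {s : SemistarOperation R K}

theorem IsHomogeneousPreserving.mem_homogeneousQuotient (hs : s.IsHomogeneousPreserving 𝒜)
    {F : NonzeroSubmodule R K} (hF : IsHomogeneouslyFG 𝒜 F.1) {z : K} (hz : z ∈ (s F).1) :
    z ∈ homogeneousQuotient (K := K) 𝒜 := by
  obtain ⟨ζ, hζ, h, -⟩ :=
    (isHomogeneousSubmodule_iff 𝒜).1 (hs F hF.isHomogeneousFractionalIdeal) z hz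
  exact ⟨ζ, hζ, h⟩

/-- The witness `G` is `F^n`, with `F^0 = R`, obtained by iterating `x H^⋆ ⊆ (F H)^⋆`. `H` itself
need not be homogeneous. -/
theorem exists_pow_mul_mem_star {F H : NonzeroSubmodule R K} (hF : IsHomogeneouslyFG 𝒜 F.1) {x : K}
    (hx : x ∈ (s (F * H)).1 / (s H).1) (n : ℕ) :
    ∃ G : NonzeroSubmodule R K, IsHomogeneouslyFG 𝒜 G.1 ∧
      ∀ y ∈ H.1, x ^ n * y ∈ (s (G * H)).1 := by
  induction n with
  | zero =>
    refine ⟨cyclic 1 one_ne_zero, IsHomogeneouslyFG.span_one, fun y hy => ?_⟩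
    rw [pow_zero]
    exact s.le_map _ (Submodule.mul_mem_mul (Submodule.mem_span_singleton_self 1) hy)
  | succ n ih =>
    obtain ⟨G, hG, h⟩ := ih
    refine ⟨F * G, hF.mul hG, fun y hy => ?_⟩
    have e : F * G * H = F * (G * H) := Subtype.ext (mul_assoc _ _ _)
    rw [e, pow_succ', mul_assoc]
    exact Submodule.mem_div_iff_forall_mul_mem.1 (s.mem_div_mul_left G hx) _ (h y hy)

theorem IsHomogeneousPreserving.exists_augmentation_eq [IsAddTorsionFree Γ]
    (hs : s.IsHomogeneousPreserving 𝒜) {E F H : NonzeroSubmodule R K}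
    (hF : IsHomogeneouslyFG 𝒜 F.1) (hFE : F ≤ E) (S : Finset R)
    (hS : H.1 = Submodule.span R (algebraMap R K '' S)) {x : K}
    (hx : x ∈ (s (F * H)).1 / (s H).1) :
    ∃ w ∈ homogeneousLift 𝒜, augmentation w = x ∧ content R w ≤ s.eabSubmodule E := by
  classical
  -- `D` replaces `H` by a homogeneous module, to which the hypothesis on `⋆` applies.
  let D : Submodule R K := S.sup fun r => content R (gradedLift 𝒜 r)
  have hD : IsHomogeneouslyFG 𝒜 D :=
    Finset.sup_induction .bot (fun _ h _ h' => h.sup h') fun r _ => .content (gradedLift_mem 𝒜 r)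
  have hrD : ∀ r ∈ S, content R (gradedLift 𝒜 r) ≤ D := fun r hr =>
    Finset.le_sup (f := fun r => content R (gradedLift (K := K) 𝒜 r)) hr
  have hHD : H.1 ≤ D := by
    rw [hS, Submodule.span_le]
    rintro _ ⟨r, hr, rfl⟩
    rw [← augmentation_gradedLift 𝒜 r]
    exact hrD r hr (augmentation_mem_content _)
  have hD0 : D ≠ ⊥ := fun e => H.2 (le_bot_iff.1 (hHD.trans e.le))
  let D' : NonzeroSubmodule R K := ⟨D, hD0⟩
  have hstar : ∀ G : NonzeroSubmodule R K, s (G * H) ≤ s (G * D') := fun G =>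
    s.mono _ _ (show G.1 * H.1 ≤ G.1 * D from mul_le_mul' le_rfl hHD)
  have hSH : ∀ r ∈ S, algebraMap R K r ∈ H.1 := fun r hr => by
    rw [hS]
    exact Submodule.subset_span ⟨r, hr, rfl⟩
  obtain ⟨r₀, hr₀, hne⟩ : ∃ r ∈ S, r ≠ 0 := by
    by_contra! h
    refine H.2 (le_bot_iff.1 ?_)
    rw [hS, Submodule.span_le]
    rintro _ ⟨r, hr, rfl⟩
    simp [h r hr]
  -- The fixed `r₀ ≠ 0` is a common denominator: `x^n r₀ ∈ (F^n D)^⋆ ⊆ R_H` for every `n`.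
  have hxR : x ∈ homogeneousQuotient (K := K) 𝒜 := by
    refine mem_homogeneousQuotient_of_forall_pow_mul_mem 𝒜 hne fun n => ?_
    obtain ⟨G, hG, h⟩ := exists_pow_mul_mem_star hF hx n
    exact hs.mem_homogeneousQuotient (F := G * D') (hG.mul hD) (hstar G (h _ (hSH r₀ hr₀)))
  obtain ⟨w, hw, rfl⟩ := hxR
  refine ⟨w, hw, rfl, ?_⟩
  have hM : ∀ r ∈ S, content R (w * gradedLift 𝒜 r) ≤ (s (F * D')).1 := by
    intro r hr
    obtain ⟨ζ, hζ, e, hζM⟩ := (isHomogeneousSubmodule_iff 𝒜).1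
      (hs (F * D') (hF.mul hD).isHomogeneousFractionalIdeal) _
      (hstar F (s.mem_div_star.1 hx _ (hSH r hr)))
    -- The product of lifts is the unique lift of `x r`, so its coefficients are the components of
    -- `x r`.
    rwa [eq_of_augmentation_eq 𝒜 (mul_mem hw (gradedLift_mem 𝒜 r)) hζ
      (by rw [e, map_mul, augmentation_gradedLift])]
  have := AddCommGroup.uniqueSums_of_isAddTorsionFree (GrothendieckAddGroup Γ)
  obtain ⟨J, hJ, hJ0, hJS⟩ :=
    exists_forall_content_mul_content_mul_le (R := R) w (gradedLift (K := K) 𝒜) S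
  let J' : NonzeroSubmodule R K := ⟨J, hJ0⟩
  -- Since `D` is the sum of the contents of the generators, it suffices to bound each one by
  -- Dedekind–Mertens with the common `J`.
  have hle : content R w * (D * J) ≤ (s (F * (D' * J'))).1 := by
    have e : F * D' * J' = F * (D' * J') := Subtype.ext (mul_assoc _ _ _)
    calc content R w * (D * J) = D * (content R w * J) := mul_left_comm _ _ _
      _ ≤ (s (F * D')).1 * J := by
        refine Submodule.le_div_iff_mul_le.1 (Finset.sup_le fun r hr => ?_)
        rw [Submodule.le_div_iff_mul_le, mul_left_comm, ← mul_assoc]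
        exact (hJS r hr).trans (mul_le_mul' (hM r hr) le_rfl)
      _ ≤ (s (F * D' * J')).1 := Submodule.mul_le.2 fun m hm n hn => s.mul_mem_star hm hn
      _ = _ := by rw [e]
  refine content_le.2 fun α => ⟨F, hF.fg, hFE, D' * J', hD.fg.mul hJ, s.mem_div_star.2 ?_⟩
  exact fun y hy => hle (Submodule.mul_mem_mul (coeff_mem_content w α) hy)

end SemistarOperation

end HomogeneousSubmodules

theorem mainTheorem1 {Γ R K : Type*} [AddCancelCommMonoid Γ] [IsAddTorsionFree Γ] [DecidableEq Γ]
    [CommRing R] [IsDomain R] (𝒜 : Γ → AddSubgroup R) [GradedRing 𝒜]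
    [Field K] [Algebra R K] [IsFractionRing R K]
    (s : SemistarOperation R K) (hs : s.IsHomogeneousPreserving 𝒜) :
    s.eab.IsHomogeneousPreserving 𝒜 := by
  refine fun E hE => (isHomogeneousSubmodule_iff 𝒜).2 ?_
  rintro x ⟨G, hG, hGE, H, hH, hx⟩
  obtain ⟨F, hF, hFE, hGF⟩ := hE.exists_fg_le hG hGE
  let F' : NonzeroSubmodule R K := ⟨F, fun e => G.2 (le_bot_iff.1 (e ▸ hGF))⟩
  obtain ⟨c, hc, S, hS⟩ := exists_ne_zero_span_mul_eq_span_algebraMap hH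
  -- Multiplying `H` by the cyclic module `R c` preserves the colon condition and moves the
  -- generators into `R`, where graded lifts exist.
  have hx' := s.mem_div_mul_left (NonzeroSubmodule.cyclic c hc) (s.mem_div_mono (F' := F') hGF hx)
  exact hs.exists_augmentation_eq (F := F') (H := NonzeroSubmodule.cyclic c hc * H) hF hFE S hS hx'
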